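/- Let $d\in\mathbb N$, $p\in[1,\infty)$, and let $\mu,\nu$ be Borel probability measures on $\mathbb R^d$ with finite $p$-th moments, $\int|x|^p\,d\mu(x)<\infty$ and $\int|x|^p\,d\nu(x)<\infty$, where $|\cdot|$ is the Euclidean norm. Let $$\mathsf W_p(\mu,\nu)=\Big(\inf_{\pi\in\Pi(\mu,\nu)}\int|x-y|^p\,d\pi(x,y)\Big)^{1/p}$$ be the $p$-Wasserstein distance, where $\Pi(\mu,\nu)$ is the set of couplings of $\mu$ and $\nu$. For $\sigma\ge 0$ let $\mathcal N_\sigma=\mathcal N(0,\sigma^2 I_d)$ (the unit mass at $0$ if $\sigma=0$), and let $\mathsf W_p^{(\sigma)}(\mu,\nu)=\mathsf W_p(\mu*\mathcal N_\sigma,\nu*\mathcal N_\sigma)$. Then $\mathsf W_p^{(\sigma)}(\mu,\nu)$ is finite for every $\sigma\ge0$, and: (i) $\mathsf W_p^{(\sigma)}(\mu,\nu)$ is continuous and monotonically non-increasing in $\sigma\in[0,\infty)$; (ii) $\lim_{\sigma\downarrow 0}\mathsf W_p^{(\sigma)}(\mu,\nu)=\mathsf W_p(\mu,\nu)$; (iii)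 if in addition $\mu$ and $\nu$ are sub-Gaussian, then $\lim_{\sigma\to\infty}\mathsf W_p^{(\sigma)}(\mu,\nu)=\big|\mathbb E[X]-\mathbb E[Y]\big|$, where $X\sim\mu$ and $Y\sim\nu$. Here $\nu$ (with $Y\sim\nu$) is called sub-Gaussian if $\mathbb E|Y|<\infty$ and there is $\beta\ge 0$ such that $\mathbb E[\exp(\langle\alpha,Y-\mathbb E[Y]\rangle)]\le\exp(\beta|\alpha|^2/2)$ for all $\alpha\in\mathbb R^d$. -/

import Mathlib

open MeasureTheory ProbabilityTheory Filter Topology Set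
open scoped ENNReal RealInnerProductSpace

noncomputable section

namespace SmoothWasserstein

variable {d : ℕ}

/-- The set `Π(μ, ν)` of couplings: measures on the product space with marginals `μ` and `ν`. -/
def couplings (μ ν : Measure (EuclideanSpace ℝ (Fin d))) :
    Set (Measure (EuclideanSpace ℝ (Fin d) × EuclideanSpace ℝ (Fin d))) :=
  {π | π.fst = μ ∧ π.snd = ν}

/-- The `p`-Wasserstein distance `(inf_π ∫ |x - y| ^ p dπ(x, y)) ^ (1 / p)`,
as an extended nonnegative number. -/
def Wp (p : ℝ) (μ ν : Measure (EuclideanSpace ℝ (Fin d))) : ℝ≥0∞ :=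
  (⨅ π ∈ couplings μ ν, ∫⁻ z, ENNReal.ofReal (‖z.1 - z.2‖ ^ p) ∂π) ^ (1 / p)

/-- The isotropic Gaussian measure `N(0, σ² I)` on `ℝᵈ`. -/
def gauss (d : ℕ) (σ : ℝ) : Measure (EuclideanSpace ℝ (Fin d)) :=
  multivariateGaussian 0 (σ ^ 2 • (1 : Matrix (Fin d) (Fin d) ℝ))

/-- The `σ`-smooth `p`-Wasserstein distance. -/
def smoothWp (p σ : ℝ) (μ ν : Measure (EuclideanSpace ℝ (Fin d))) : ℝ≥0∞ :=
  Wp p (Measure.conv μ (gauss d σ)) (Measure.conv ν (gauss d σ))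

/-- `ν` is `β`-sub-Gaussian: `β ≥ 0`, `E|Y| < ∞` and
`E exp ⟪α, Y - E Y⟫ ≤ exp (β |α|² / 2)` for all `α`, where `Y ∼ ν`. The integrability of the
exponential is part of the inequality, since the Bochner integral of a non-integrable function
is `0`. -/
structure IsSubGaussian (β : ℝ) (ν : Measure (EuclideanSpace ℝ (Fin d))) : Prop where
  nonneg : 0 ≤ β
  integrable_id : Integrable (fun y => y) ν
  integrable_exp : ∀ α : EuclideanSpace ℝ (Fin d),
    Integrable (fun y => Real.exp ⟪α, y - ∫ z, z ∂ν⟫) ν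
  integral_exp_le : ∀ α : EuclideanSpace ℝ (Fin d),
    ∫ y, Real.exp ⟪α, y - ∫ z, z ∂ν⟫ ∂ν ≤ Real.exp (β * ‖α‖ ^ 2 / 2)

end SmoothWasserstein

end

namespace SmoothWasserstein

variable {d : ℕ} {p : ℝ}

/-! Adding the same independent noise to both coordinates of a coupling leaves their difference
unchanged, so convolution contracts `Wp` (`Wp_conv_le`). As Gaussian variances add, more noise means
further convolution; this gives monotonicity, and finiteness from `σ = 0`. Coupling `X + sG` with `X
+ tG` through the same `X` and standard Gaussian `G` costs `|s - t| ‖G‖_p`. By the triangle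
inequality the smoothed distance is thus Lipschitz in `σ`, which also gives the limit at `0`.

For large noise, the distance of the means is a lower bound by Jensen, and smoothing preserves
means. For the upper bound it suffices that each law merges with the point mass at its mean
(`tendsto_smoothWp_dirac_mean`). By contraction, `Lᵖ` approximation by simple functions reduces this
to finitely supported laws. Joint convexity of `Wp ^ p` and induction on the atoms reduce those to
two atoms.

Two atoms lie on a line, and the Gaussian is the convolution of its parts along and orthogonal to
that line, so the question is one-dimensional. There the monotone rearrangement from `N(0, σ²)` to
its convolution with a centered two-point law moves points by a bounded amount. The displacement
tends to `0` pointwise, because to first order in `1 / σ` the mixed distribution function sees only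
the mean, which is `0`. Dominated convergence concludes (`exists_transport_twoPointGauss`). -/

/-! ### Couplings and the Wasserstein distance -/

lemma Wp_eq_iInf_enorm (hp : 0 ≤ p) (μ ν : Measure (EuclideanSpace ℝ (Fin d))) :
    Wp p μ ν = (⨅ π ∈ couplings μ ν, ∫⁻ z, ‖z.1 - z.2‖ₑ ^ p ∂π) ^ (1 / p) := by
  simp only [Wp, ← ofReal_norm, ENNReal.ofReal_rpow_of_nonneg (norm_nonneg _) hp]

lemma Wp_rpow (hp : 0 < p) (μ ν : Measure (EuclideanSpace ℝ (Fin d))) :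
    Wp p μ ν ^ p = ⨅ π ∈ couplings μ ν, ∫⁻ z, ‖z.1 - z.2‖ₑ ^ p ∂π := by
  rw [Wp_eq_iInf_enorm hp.le, one_div, ENNReal.rpow_inv_rpow hp.ne']

lemma Wp_le_of_mem_couplings (hp : 0 ≤ p) {μ ν : Measure (EuclideanSpace ℝ (Fin d))}
    {π : Measure (EuclideanSpace ℝ (Fin d) × EuclideanSpace ℝ (Fin d))} (hπ : π ∈ couplings μ ν) :
    Wp p μ ν ≤ (∫⁻ z, ‖z.1 - z.2‖ₑ ^ p ∂π) ^ (1 / p) := by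
  rw [Wp_eq_iInf_enorm hp]
  exact ENNReal.rpow_le_rpow (iInf₂_le π hπ) (by positivity)

lemma exists_coupling_of_Wp_lt (hp : 0 < p) {μ ν : Measure (EuclideanSpace ℝ (Fin d))} {c : ℝ≥0∞}
    (h : Wp p μ ν < c) : ∃ π ∈ couplings μ ν, (∫⁻ z, ‖z.1 - z.2‖ₑ ^ p ∂π) ^ (1 / p) < c := by
  have h' : Wp p μ ν ^ p < c ^ p := ENNReal.rpow_lt_rpow h hp
  rw [Wp_rpow hp] at h'
  obtain ⟨π, hπ, hlt⟩ := by simpa only [iInf_lt_iff] using h'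
  refine ⟨π, hπ, ?_⟩
  rw [one_div]
  exact (ENNReal.rpow_inv_lt_iff hp).2 hlt

/-- Two measurable maps on a common measure space give a coupling of their laws. -/
lemma Wp_map_le (hp : 0 ≤ p) {Ω : Type*} [MeasurableSpace Ω] (Q : Measure Ω)
    {f g : Ω → EuclideanSpace ℝ (Fin d)} (hf : Measurable f) (hg : Measurable g) :
    Wp p (Q.map f) (Q.map g) ≤ (∫⁻ ω, ‖f ω - g ω‖ₑ ^ p ∂Q) ^ (1 / p) := by
  have h := Wp_le_of_mem_couplings (p := p) (π := Q.map fun ω => (f ω, g ω)) hp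
    (show _ ∈ couplings (Q.map f) (Q.map g) from
      ⟨Measure.fst_map_prodMk hg, Measure.snd_map_prodMk hf⟩)
  rwa [lintegral_map (by fun_prop) (by fun_prop)] at h

/-- Gluing of two couplings along their common marginal. -/
lemma exists_gluing {X Y Z : Type*} [MeasurableSpace X] [MeasurableSpace Y] [MeasurableSpace Z]
    [StandardBorelSpace X] [Nonempty X] [StandardBorelSpace Z] [Nonempty Z]
    (π₁ : Measure (X × Y)) (π₂ : Measure (Y × Z)) [IsFiniteMeasure π₁] [IsFiniteMeasure π₂]
    (h : π₁.snd = π₂.fst) :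
    ∃ Q : Measure (Y × X × Z), Q.map (fun w => (w.2.1, w.1)) = π₁ ∧
      Q.map (fun w => (w.1, w.2.2)) = π₂ := by
  -- The shared variable is put first, so that both couplings disintegrate over it.
  set π₁' : Measure (Y × X) := π₁.map Prod.swap with hπ₁'
  have hfst : π₁'.fst = π₂.fst := by
    rw [← h, Measure.fst, hπ₁', Measure.map_map measurable_fst measurable_swap]; rfl
  have h₁ : π₂.fst ⊗ₘ π₁'.condKernel = π₁' := by rw [← hfst]; exact π₁'.disintegrate _
  have h₂ : π₂.fst ⊗ₘ π₂.condKernel = π₂ := π₂.disintegrate _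
  -- The outer variables are made conditionally independent given the shared one.
  refine ⟨π₂.fst ⊗ₘ (π₁'.condKernel.prod π₂.condKernel), ?_, ?_⟩
  · have : (fun w : Y × X × Z => (w.2.1, w.1)) = Prod.swap ∘ Prod.map id Prod.fst := rfl
    rw [this, ← Measure.map_map measurable_swap (by fun_prop), ← Measure.compProd_map measurable_fst,
      ← Kernel.fst_eq, Kernel.fst_prod, h₁, hπ₁', Measure.map_map measurable_swap measurable_swap]
    simp
  · have : (fun w : Y × X × Z => (w.1, w.2.2)) = Prod.map id Prod.snd := rfl
    rw [this, ← Measure.compProd_map measurable_snd, ← Kernel.snd_eq, Kernel.snd_prod, h₂]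

lemma isProbabilityMeasure_of_mem_couplings {μ ν : Measure (EuclideanSpace ℝ (Fin d))}
    [IsProbabilityMeasure μ] {π : Measure (EuclideanSpace ℝ (Fin d) × EuclideanSpace ℝ (Fin d))}
    (hπ : π ∈ couplings μ ν) : IsProbabilityMeasure π := by
  refine ⟨?_⟩
  rw [← Measure.fst_univ, hπ.1, measure_univ]

/-- Minkowski's inequality in `Lᵖ` of the glued measure. -/
lemma Wp_le_of_couplings (hp : 1 ≤ p) {μ ν ρ : Measure (EuclideanSpace ℝ (Fin d))}
    [IsProbabilityMeasure μ] [IsProbabilityMeasure ν]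
    {π₁ π₂ : Measure (EuclideanSpace ℝ (Fin d) × EuclideanSpace ℝ (Fin d))}
    (h₁ : π₁ ∈ couplings μ ν) (h₂ : π₂ ∈ couplings ν ρ) :
    Wp p μ ρ ≤ (∫⁻ z, ‖z.1 - z.2‖ₑ ^ p ∂π₁) ^ (1 / p) +
      (∫⁻ z, ‖z.1 - z.2‖ₑ ^ p ∂π₂) ^ (1 / p) := by
  have hp0 : 0 ≤ p := by linarith
  have := isProbabilityMeasure_of_mem_couplings h₁
  have := isProbabilityMeasure_of_mem_couplings h₂
  obtain ⟨Q, hQ₁, hQ₂⟩ := exists_gluing π₁ π₂ (h₁.2.trans h₂.1.symm)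
  have e₁ : Q.map (fun w => w.2.1) = μ := by
    rw [← h₁.1, Measure.fst, ← hQ₁, Measure.map_map (by fun_prop) (by fun_prop)]; rfl
  have e₂ : Q.map (fun w => w.2.2) = ρ := by
    rw [← h₂.2, Measure.snd, ← hQ₂, Measure.map_map (by fun_prop) (by fun_prop)]; rfl
  have h := Wp_map_le hp0 Q (f := fun w => w.2.1) (g := fun w => w.2.2) (by fun_prop) (by fun_prop)
  rw [e₁, e₂] at h
  rw [← hQ₁, ← hQ₂, lintegral_map (by fun_prop) (by fun_prop),
    lintegral_map (by fun_prop) (by fun_prop)]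
  refine h.trans (le_trans ?_ (ENNReal.lintegral_Lp_add_le (μ := Q)
    (f := fun w => ‖w.2.1 - w.1‖ₑ) (g := fun w => ‖w.1 - w.2.2‖ₑ) (by fun_prop) (by fun_prop) hp))
  gcongr with w
  simpa [edist_eq_enorm_sub] using edist_triangle w.2.1 w.1 w.2.2

lemma Wp_eq_iInf_rpow (hp : 0 < p) (μ ν : Measure (EuclideanSpace ℝ (Fin d))) :
    Wp p μ ν = ⨅ π : couplings μ ν, (∫⁻ z, ‖z.1 - z.2‖ₑ ^ p ∂π.1) ^ (1 / p) := by
  rw [Wp_eq_iInf_enorm hp.le, iInf_subtype']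
  exact (ENNReal.orderIsoRpow (1 / p) (by positivity)).map_iInf _

lemma Wp_triangle (hp : 1 ≤ p) (μ ν ρ : Measure (EuclideanSpace ℝ (Fin d)))
    [IsProbabilityMeasure μ] [IsProbabilityMeasure ν] :
    Wp p μ ρ ≤ Wp p μ ν + Wp p ν ρ := by
  have hp0 : 0 < p := by linarith
  rw [Wp_eq_iInf_rpow hp0 μ ν, Wp_eq_iInf_rpow hp0 ν ρ]
  exact ENNReal.le_iInf_add_iInf fun π₁ π₂ => Wp_le_of_couplings hp π₁.2 π₂.2

lemma Wp_conv_le (hp : 0 < p) (μ ν ρ : Measure (EuclideanSpace ℝ (Fin d)))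
    [IsProbabilityMeasure μ] [IsProbabilityMeasure ρ] :
    Wp p (μ.conv ρ) (ν.conv ρ) ≤ Wp p μ ν := by
  refine le_of_forall_gt fun c hc => ?_
  obtain ⟨π, hπ, hlt⟩ := exists_coupling_of_Wp_lt hp hc
  have := isProbabilityMeasure_of_mem_couplings hπ
  refine lt_of_le_of_lt ?_ hlt
  have h := Wp_map_le hp.le (π.prod ρ) (f := fun w => w.1.1 + w.2) (g := fun w => w.1.2 + w.2)
    (by fun_prop) (by fun_prop)
  have key : ∀ φ : EuclideanSpace ℝ (Fin d) × EuclideanSpace ℝ (Fin d) → EuclideanSpace ℝ (Fin d),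
      Measurable φ → (π.prod ρ).map (fun w => φ w.1 + w.2) = (π.map φ).conv ρ := by
    intro φ hφ
    rw [Measure.conv, ← Measure.map_id (μ := ρ), Measure.map_prod_map _ _ hφ measurable_id,
      Measure.map_map (by fun_prop) (by fun_prop), Measure.map_id]
    rfl
  rw [key _ measurable_fst, key _ measurable_snd] at h
  have e1 : π.map Prod.fst = μ := hπ.1
  have e2 : π.map Prod.snd = ν := hπ.2
  rw [e1, e2] at h
  refine h.trans_eq ?_
  simp only [add_sub_add_right_eq_sub]
  rw [lintegral_prod _ (by fun_prop)]
  simp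

/-- A combination of couplings couples the combinations, and the cost is linear in the coupling.
Weights that are nonzero and finite commute with the infima. -/
lemma Wp_rpow_convexComb_le (hp : 0 < p) {a b : ℝ≥0∞} (ha : a ≠ 0) (ha' : a ≠ ∞) (hb : b ≠ 0)
    (hb' : b ≠ ∞) (μ₁ μ₂ ν₁ ν₂ : Measure (EuclideanSpace ℝ (Fin d))) :
    Wp p (a • μ₁ + b • μ₂) (a • ν₁ + b • ν₂) ^ p ≤ a * Wp p μ₁ ν₁ ^ p + b * Wp p μ₂ ν₂ ^ p := by
  rw [Wp_rpow hp μ₁, Wp_rpow hp μ₂, iInf_subtype', iInf_subtype', ENNReal.mul_iInf_of_ne ha ha',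
    ENNReal.mul_iInf_of_ne hb hb']
  refine ENNReal.le_iInf_add_iInf fun ⟨π₁, hπ₁⟩ ⟨π₂, hπ₂⟩ => ?_
  have hmem : a • π₁ + b • π₂ ∈ couplings (a • μ₁ + b • μ₂) (a • ν₁ + b • ν₂) := by
    constructor
    · rw [← hπ₁.1, ← hπ₂.1]
      simp [Measure.fst, Measure.map_add _ _ measurable_fst, Measure.map_smul]
    · rw [← hπ₁.2, ← hπ₂.2]
      simp [Measure.snd, Measure.map_add _ _ measurable_snd, Measure.map_smul]
  rw [Wp_rpow hp]
  refine (iInf₂_le _ hmem).trans_eq ?_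
  simp only [lintegral_add_measure, lintegral_smul_measure, smul_eq_mul]

/-- Under any coupling the difference of the means is the mean of the difference; its norm is at
most the `L¹` norm, hence at most the `Lᵖ` norm. -/
lemma enorm_integral_sub_le_Wp (hp : 1 ≤ p) (μ ν : Measure (EuclideanSpace ℝ (Fin d)))
    [IsProbabilityMeasure μ] (hμ : Integrable (fun x => x) μ) (hν : Integrable (fun x => x) ν) :
    ENNReal.ofReal ‖(∫ x, x ∂μ) - ∫ y, y ∂ν‖ ≤ Wp p μ ν := by
  have hp0 : 0 < p := by linarith
  refine le_of_forall_gt fun c hc => ?_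
  obtain ⟨π, hπ, hlt⟩ := exists_coupling_of_Wp_lt hp0 hc
  have := isProbabilityMeasure_of_mem_couplings hπ
  refine lt_of_le_of_lt ?_ hlt
  have e1 : π.map Prod.fst = μ := hπ.1
  have e2 : π.map Prod.snd = ν := hπ.2
  have i1 : Integrable (fun z => z.1) π := by
    rw [← e1] at hμ; exact hμ.comp_measurable measurable_fst
  have i2 : Integrable (fun z => z.2) π := by
    rw [← e2] at hν; exact hν.comp_measurable measurable_snd
  have hm : (∫ x, x ∂μ) - ∫ y, y ∂ν = ∫ z, (z.1 - z.2) ∂π := by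
    rw [integral_sub i1 i2, ← e1, ← e2, integral_map (by fun_prop) (by fun_prop),
      integral_map (by fun_prop) (by fun_prop)]
  rw [hm, ofReal_norm]
  refine (enorm_integral_le_lintegral_enorm _).trans ?_
  have h := eLpNorm_le_eLpNorm_of_exponent_le (μ := π) (f := fun z => z.1 - z.2) (p := 1)
    (q := ENNReal.ofReal p) (by simpa using hp) (by fun_prop)
  rw [eLpNorm_one_eq_lintegral_enorm, eLpNorm_eq_lintegral_rpow_enorm_toReal (by simpa using hp0)
    (by simp), ENNReal.toReal_ofReal hp0.le] at h
  exact h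

lemma Wp_dirac_zero_right_le (hp : 0 ≤ p) (μ : Measure (EuclideanSpace ℝ (Fin d)))
    [IsProbabilityMeasure μ] : Wp p μ (.dirac 0) ≤ (∫⁻ x, ‖x‖ₑ ^ p ∂μ) ^ (1 / p) := by
  have h := Wp_map_le hp μ (f := id) (g := fun _ => 0) measurable_id measurable_const
  simpa using h

lemma Wp_dirac_zero_left_le (hp : 0 ≤ p) (μ : Measure (EuclideanSpace ℝ (Fin d)))
    [IsProbabilityMeasure μ] : Wp p (.dirac 0) μ ≤ (∫⁻ x, ‖x‖ₑ ^ p ∂μ) ^ (1 / p) := by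
  have h := Wp_map_le hp μ (f := fun _ => 0) (g := id) measurable_const measurable_id
  simpa using h

lemma lintegral_enorm_rpow_ne_top (hp : 0 ≤ p) {μ : Measure (EuclideanSpace ℝ (Fin d))}
    (hμ : Integrable (fun x => ‖x‖ ^ p) μ) : ∫⁻ x, ‖x‖ₑ ^ p ∂μ ≠ ∞ := by
  have h := hμ.lintegral_lt_top.ne
  simpa only [← ofReal_norm, ENNReal.ofReal_rpow_of_nonneg (norm_nonneg _) hp] using h

lemma Wp_ne_top (hp : 1 ≤ p) {μ ν : Measure (EuclideanSpace ℝ (Fin d))} [IsProbabilityMeasure μ]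
    [IsProbabilityMeasure ν] (hμ : Integrable (fun x => ‖x‖ ^ p) μ)
    (hν : Integrable (fun x => ‖x‖ ^ p) ν) : Wp p μ ν ≠ ∞ := by
  have hp0 : 0 ≤ p := by linarith
  refine ne_top_of_le_ne_top ?_ (Wp_triangle hp μ (.dirac 0) ν)
  refine ENNReal.add_ne_top.2 ⟨ne_top_of_le_ne_top ?_ (Wp_dirac_zero_right_le hp0 μ),
    ne_top_of_le_ne_top ?_ (Wp_dirac_zero_left_le hp0 ν)⟩
  · exact ENNReal.rpow_ne_top_of_nonneg (by positivity) (lintegral_enorm_rpow_ne_top hp0 hμ)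
  · exact ENNReal.rpow_ne_top_of_nonneg (by positivity) (lintegral_enorm_rpow_ne_top hp0 hν)

/-! ### Gaussian measures and their splitting along a line -/

lemma charFun_gauss (σ : ℝ) (t : EuclideanSpace ℝ (Fin d)) :
    charFun (gauss d σ) t = Complex.exp (-(σ ^ 2 * ‖t‖ ^ 2 : ℝ) / 2) := by
  rw [gauss, charFun_multivariateGaussian (Matrix.PosSemidef.one.smul (sq_nonneg σ))]
  have h : t.ofLp ⬝ᵥ t.ofLp = ‖t‖ ^ 2 := by
    rw [EuclideanSpace.real_norm_sq_eq]
    simp [dotProduct, sq]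
  simp [Matrix.smul_mulVec, dotProduct_smul, h, neg_div]

instance isProbabilityMeasure_gauss (σ : ℝ) : IsProbabilityMeasure (gauss d σ) := by
  unfold gauss; infer_instance

lemma gauss_conv_gauss (σ τ ρ : ℝ) (h : σ ^ 2 + τ ^ 2 = ρ ^ 2) :
    (gauss d σ).conv (gauss d τ) = gauss d ρ := by
  refine Measure.ext_of_charFun (funext fun t => ?_)
  rw [charFun_conv, charFun_gauss, charFun_gauss, charFun_gauss, ← Complex.exp_add, ← h]
  congr 1
  push_cast
  ring

lemma gauss_zero : gauss d 0 = .dirac 0 := by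
  refine Measure.ext_of_charFun (funext fun t => ?_)
  rw [charFun_gauss]
  simp

lemma gauss_eq_map_smul (σ : ℝ) : gauss d σ = (gauss d 1).map (fun x => σ • x) := by
  refine Measure.ext_of_charFun (funext fun t => ?_)
  rw [charFun_map_smul, charFun_gauss, charFun_gauss, norm_smul, mul_pow]
  simp

lemma lintegral_enorm_rpow_gauss_ne_top (hp : 0 < p) (σ : ℝ) :
    ∫⁻ x, ‖x‖ₑ ^ p ∂(gauss d σ) ≠ ∞ := by
  have h : IsGaussian (gauss d σ) := by unfold gauss; infer_instance
  have h' := (IsGaussian.memLp_id (gauss d σ) (ENNReal.ofReal p) (by simp)).eLpNorm_lt_top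
  have h2 := (eLpNorm_lt_top_iff_lintegral_rpow_enorm_lt_top (by simpa using hp) (by simp)).1 h'
  rw [ENNReal.toReal_ofReal hp.le] at h2
  exact h2.ne

/-- The law of `σ g u` for a standard normal variable `g`. -/
noncomputable def gaussLine (u : EuclideanSpace ℝ (Fin d)) (σ : ℝ) :
    Measure (EuclideanSpace ℝ (Fin d)) :=
  (gaussianReal 0 1).map fun z => (σ * z) • u

/-- The law of the component orthogonal to `u` of a Gaussian vector, for a unit vector `u`. -/
noncomputable def gaussPerp (u : EuclideanSpace ℝ (Fin d)) (σ : ℝ) :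
    Measure (EuclideanSpace ℝ (Fin d)) :=
  (gauss d σ).map fun x => x - ⟪u, x⟫ • u

instance (u : EuclideanSpace ℝ (Fin d)) (σ : ℝ) : IsProbabilityMeasure (gaussLine u σ) :=
  Measure.isProbabilityMeasure_map (by fun_prop)

instance (u : EuclideanSpace ℝ (Fin d)) (σ : ℝ) : IsProbabilityMeasure (gaussPerp u σ) :=
  Measure.isProbabilityMeasure_map (by fun_prop)

/-- Characteristic functions multiply, and Pythagoras splits `‖t‖ ^ 2` in the exponent. -/
lemma gaussLine_conv_gaussPerp {u : EuclideanSpace ℝ (Fin d)} (hu : ‖u‖ = 1) (σ : ℝ) :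
    (gaussLine u σ).conv (gaussPerp u σ) = gauss d σ := by
  refine Measure.ext_of_charFun (funext fun t => ?_)
  have h₁ : charFun (gaussLine u σ) t = charFun (gaussianReal 0 1) (σ * ⟪u, t⟫) := by
    rw [charFun_apply, charFun_apply_real, gaussLine, integral_map (by fun_prop) (by fun_prop)]
    congr 1 with z
    rw [real_inner_smul_left]
    push_cast
    ring_nf
  have h₂ : charFun (gaussPerp u σ) t = charFun (gauss d σ) (t - ⟪u, t⟫ • u) := by
    rw [charFun_apply, charFun_apply, gaussPerp, integral_map (by fun_prop) (by fun_prop)]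
    congr 1 with z
    rw [inner_sub_left, inner_sub_right, real_inner_smul_left, real_inner_smul_right,
      real_inner_comm u z]
    ring_nf
  have h₃ : ‖t - ⟪u, t⟫ • u‖ ^ 2 = ‖t‖ ^ 2 - ⟪u, t⟫ ^ 2 := by
    rw [norm_sub_sq_real, real_inner_smul_right, norm_smul, hu, real_inner_comm, mul_one,
      Real.norm_eq_abs, sq_abs]
    ring
  rw [charFun_conv, h₁, h₂, charFun_gauss, charFun_gauss, charFun_gaussianReal,
    ← Complex.exp_add, h₃]
  congr 1
  push_cast
  ring

/-! ### One-dimensional transport between a Gaussian and a two-point mixture -/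

/-- The monotone rearrangement between two laws on the line whose distribution functions are
continuous, strictly increasing, and shifts of one another by at most `M`. -/
lemma exists_rearrangement (γ ν : Measure ℝ) [IsProbabilityMeasure γ] [IsProbabilityMeasure ν]
    (hγ : Continuous (cdf γ)) (hγm : StrictMono (cdf γ)) (hν : Continuous (cdf ν))
    (hνm : StrictMono (cdf ν)) {M : ℝ} (hM : 0 ≤ M) (h₁ : ∀ x, cdf γ (x - M) ≤ cdf ν x)
    (h₂ : ∀ x, cdf ν x ≤ cdf γ (x + M)) :
    ∃ T : ℝ → ℝ, Measurable T ∧ γ.map T = ν ∧ (∀ x, cdf ν (T x) = cdf γ x) ∧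
      ∀ x, |T x - x| ≤ M := by
  -- Solving for the quantile inside the window `[x - M, x + M]` yields the displacement bound at
  -- once.
  have hT : ∀ x, ∃ y ∈ Icc (x - M) (x + M), cdf ν y = cdf γ x := fun x =>
    intermediate_value_Icc (by linarith) hν.continuousOn
      ⟨(h₂ (x - M)).trans_eq (by ring_nf), (h₁ (x + M)).trans_eq' (by ring_nf)⟩
  choose T hTM hTe using hT
  have hTm : Monotone T := fun x y hxy => by
    rw [← hνm.le_iff_le, hTe, hTe]
    exact hγm.monotone hxy
  refine ⟨T, hTm.measurable, ?_, hTe, fun x => ?_⟩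
  · have := Measure.isProbabilityMeasure_map (μ := γ) hTm.measurable.aemeasurable
    refine Measure.eq_of_cdf _ _ (StieltjesFunction.ext fun y => ?_)
    obtain ⟨x, -, hx⟩ : ∃ x ∈ Icc (y - M) (y + M), cdf γ x = cdf ν y :=
      intermediate_value_Icc (by linarith) hγ.continuousOn ⟨h₁ y, h₂ y⟩
    have hset : T ⁻¹' Iic y = Iic x := by
      ext z
      rw [mem_preimage, mem_Iic, mem_Iic, ← hνm.le_iff_le, hTe, ← hx, hγm.le_iff_le]
    rw [cdf_eq_real, map_measureReal_apply hTm.measurable measurableSet_Iic, hset, ← cdf_eq_real,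
      hx]
  · have := hTM x
    rw [abs_le]
    constructor <;> linarith [this.1, this.2]

lemma hasDerivAt_cdf_gaussianReal (x : ℝ) :
    HasDerivAt (cdf (gaussianReal 0 1)) (gaussianPDFReal 0 1 x) x := by
  have hc : Continuous (gaussianPDFReal 0 1) := by
    unfold gaussianPDFReal
    fun_prop
  have hi : Integrable (gaussianPDFReal 0 1) := integrable_gaussianPDFReal 0 1
  have he : ∀ y, cdf (gaussianReal 0 1) y =
      cdf (gaussianReal 0 1) 0 + ∫ t in (0 : ℝ)..y, gaussianPDFReal 0 1 t := by
    have : ∀ y, cdf (gaussianReal 0 1) y = ∫ t in Iic y, gaussianPDFReal 0 1 t := fun y => by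
      rw [cdf_eq_real, measureReal_def, gaussianReal_apply_eq_integral _ one_ne_zero,
        ENNReal.toReal_ofReal (integral_nonneg fun t => gaussianPDFReal_nonneg 0 1 t)]
    intro y
    rw [this, this, ← intervalIntegral.integral_Iic_sub_Iic hi.integrableOn hi.integrableOn]
    ring
  have hd := (intervalIntegral.integral_hasDerivAt_right (hc.intervalIntegrable 0 x)
    (hc.stronglyMeasurableAtFilter _ _) hc.continuousAt).const_add (cdf (gaussianReal 0 1) 0)
  exact hd.congr_of_eventuallyEq (Eventually.of_forall he)

lemma strictMono_cdf_gaussianReal : StrictMono (cdf (gaussianReal 0 1)) :=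
  strictMono_of_deriv_pos fun x => by
    rw [(hasDerivAt_cdf_gaussianReal x).deriv]
    exact gaussianPDFReal_pos 0 1 x one_ne_zero

lemma continuous_cdf_gaussianReal : Continuous (cdf (gaussianReal 0 1)) :=
  continuous_iff_continuousAt.2 fun x => (hasDerivAt_cdf_gaussianReal x).continuousAt

/-- The law of `ξ + σ g`, where `ξ` takes the values `w` and `v` with weights `a` and `b`. -/
noncomputable def twoPointGauss (a b w v σ : ℝ) : Measure ℝ :=
  ENNReal.ofReal a • (gaussianReal 0 1).map (fun z => w + σ * z) +
    ENNReal.ofReal b • (gaussianReal 0 1).map (fun z => v + σ * z)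

lemma isProbabilityMeasure_twoPointGauss {a b : ℝ} (ha : 0 ≤ a) (hb : 0 ≤ b) (hab : a + b = 1)
    (w v σ : ℝ) : IsProbabilityMeasure (twoPointGauss a b w v σ) := by
  have h : ∀ x : ℝ, IsProbabilityMeasure ((gaussianReal 0 1).map (fun z => x + σ * z)) := fun x =>
    Measure.isProbabilityMeasure_map (by fun_prop)
  refine ⟨?_⟩
  simp [twoPointGauss, ← ENNReal.ofReal_add ha hb, hab]

lemma real_Iic_map_add_mul {σ : ℝ} (hσ : 0 < σ) (x y : ℝ) :
    ((gaussianReal 0 1).map (fun z => x + σ * z)).real (Iic y) =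
      cdf (gaussianReal 0 1) ((y - x) / σ) := by
  rw [map_measureReal_apply (by fun_prop) measurableSet_Iic, cdf_eq_real]
  congr 1
  ext z
  rw [mem_preimage, mem_Iic, mem_Iic, le_div_iff₀ hσ]
  constructor <;> intro h <;> linarith

lemma cdf_twoPointGauss {a b : ℝ} (ha : 0 ≤ a) (hb : 0 ≤ b) (hab : a + b = 1)
    (w v : ℝ) {σ : ℝ} (hσ : 0 < σ) (y : ℝ) :
    cdf (twoPointGauss a b w v σ) y = a * cdf (gaussianReal 0 1) ((y - w) / σ) +
      b * cdf (gaussianReal 0 1) ((y - v) / σ) := by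
  have := isProbabilityMeasure_twoPointGauss ha hb hab w v σ
  rw [cdf_eq_real, twoPointGauss, measureReal_add_apply
      (ENNReal.mul_ne_top ENNReal.ofReal_ne_top (measure_ne_top _ _))
      (ENNReal.mul_ne_top ENNReal.ofReal_ne_top (measure_ne_top _ _)),
    measureReal_ennreal_smul_apply, measureReal_ennreal_smul_apply, real_Iic_map_add_mul hσ,
    real_Iic_map_add_mul hσ, ENNReal.toReal_ofReal ha, ENNReal.toReal_ofReal hb]

lemma strictMono_cdf_twoPointGauss {a b : ℝ} (ha : 0 ≤ a) (hb : 0 ≤ b) (hab : a + b = 1)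
    (w v : ℝ) {σ : ℝ} (hσ : 0 < σ) : StrictMono (cdf (twoPointGauss a b w v σ)) := by
  intro x y hxy
  have h : ∀ u : ℝ, cdf (gaussianReal 0 1) ((x - u) / σ) < cdf (gaussianReal 0 1) ((y - u) / σ) :=
    fun u => strictMono_cdf_gaussianReal (by gcongr)
  rw [cdf_twoPointGauss ha hb hab w v hσ, cdf_twoPointGauss ha hb hab w v hσ]
  rcases ha.eq_or_lt with rfl | ha'
  · obtain rfl : b = 1 := by linarith
    simpa using h v
  · exact add_lt_add_of_lt_of_le (mul_lt_mul_of_pos_left (h w) ha')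
      (mul_le_mul_of_nonneg_left (h v).le hb)

/-- To first order in `s`, the mixture of the distribution functions of a centered two-point law
only sees the shift `η`. -/
lemma hasDerivAt_mixture {a b w v : ℝ} (hab : a + b = 1) (hmean : a * w + b * v = 0) (z η : ℝ) :
    HasDerivAt (fun s => a * cdf (gaussianReal 0 1) (z + s * (η - w)) +
        b * cdf (gaussianReal 0 1) (z + s * (η - v))) (gaussianPDFReal 0 1 z * η) 0 := by
  have hd : ∀ x : ℝ, HasDerivAt (fun s : ℝ => cdf (gaussianReal 0 1) (z + s * (η - x)))
      (gaussianPDFReal 0 1 z * (η - x)) 0 := fun x => by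
    have h1 : HasDerivAt (fun s : ℝ => z + s * (η - x)) (η - x) 0 := by
      simpa using ((hasDerivAt_id (0 : ℝ)).mul_const (η - x)).const_add z
    refine HasDerivAt.comp (h₂ := cdf (gaussianReal 0 1)) (0 : ℝ) ?_ h1
    simpa using hasDerivAt_cdf_gaussianReal (z + 0 * (η - x))
  refine (((hd w).const_mul a).add ((hd v).const_mul b)).congr_deriv ?_
  linear_combination (gaussianPDFReal 0 1 z * η) * hab - gaussianPDFReal 0 1 z * hmean

/-- With `s = 1 / σ` the right side is the mixture's distribution function at `σ z + η`, so the
rearrangement sends `σ z` below `σ z + η`. The next lemma is the matching lower bound. -/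
lemma eventually_lt_mixture {a b w v : ℝ} (hab : a + b = 1) (hmean : a * w + b * v = 0) (z : ℝ)
    {η : ℝ} (hη : 0 < η) :
    ∀ᶠ s in 𝓝[>] (0 : ℝ), cdf (gaussianReal 0 1) z <
      a * cdf (gaussianReal 0 1) (z + s * (η - w)) +
        b * cdf (gaussianReal 0 1) (z + s * (η - v)) := by
  have hpos : 0 < gaussianPDFReal 0 1 z * η := mul_pos (gaussianPDFReal_pos 0 1 z one_ne_zero) hη
  filter_upwards [(hasDerivAt_mixture hab hmean z η).tendsto_slope_zero_right.eventually
    (lt_mem_nhds hpos), self_mem_nhdsWithin] with s hs hs0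
  simp only [smul_eq_mul, zero_add, zero_mul, add_zero, ← add_mul, hab, one_mul] at hs
  have := (pos_iff_pos_of_mul_pos hs).1 (inv_pos.2 hs0)
  linarith

lemma eventually_mixture_lt {a b w v : ℝ} (hab : a + b = 1) (hmean : a * w + b * v = 0) (z : ℝ)
    {η : ℝ} (hη : 0 < η) :
    ∀ᶠ s in 𝓝[>] (0 : ℝ), a * cdf (gaussianReal 0 1) (z + s * (-η - w)) +
        b * cdf (gaussianReal 0 1) (z + s * (-η - v)) < cdf (gaussianReal 0 1) z := by
  have hneg : gaussianPDFReal 0 1 z * -η < 0 :=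
    mul_neg_of_pos_of_neg (gaussianPDFReal_pos 0 1 z one_ne_zero) (neg_neg_of_pos hη)
  filter_upwards [(hasDerivAt_mixture hab hmean z (-η)).tendsto_slope_zero_right.eventually
    (gt_mem_nhds hneg), self_mem_nhdsWithin] with s hs hs0
  simp only [smul_eq_mul, zero_add, zero_mul, add_zero, ← add_mul, hab, one_mul] at hs
  by_contra! hcon
  exact hs.not_ge (mul_nonneg (inv_pos.2 hs0).le (by linarith))

/-- A centered two-point law is absorbed by a large Gaussian noise: there are transport maps from
`N(0, σ²)` to its convolution with the two-point law whose displacement tends to `0` in `Lᵖ`. -/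
lemma exists_transport_twoPointGauss (hp : 0 < p) {a b w v : ℝ} (ha : 0 ≤ a) (hb : 0 ≤ b)
    (hab : a + b = 1) (hmean : a * w + b * v = 0) :
    ∃ T : ℝ → ℝ → ℝ, (∀ σ, 0 < σ → Measurable (T σ) ∧
      (gaussianReal 0 1).map (T σ) = twoPointGauss a b w v σ) ∧
      Tendsto (fun σ => ∫⁻ z, ‖T σ z - σ * z‖ₑ ^ p ∂(gaussianReal 0 1)) atTop (𝓝 0) := by
  set M := max |w| |v| with hMdef
  have hM : 0 ≤ M := (abs_nonneg w).trans (le_max_left _ _)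
  have hw : |w| ≤ M := le_max_left _ _
  have hv : |v| ≤ M := le_max_right _ _
  rw [abs_le] at hw hv
  have key : ∀ σ : ℝ, ∃ S : ℝ → ℝ, 0 < σ → (Measurable S ∧
      (gaussianReal 0 1).map (fun z => S (σ * z)) = twoPointGauss a b w v σ ∧
      (∀ z, cdf (twoPointGauss a b w v σ) (S (σ * z)) = cdf (gaussianReal 0 1) z) ∧
      ∀ x, |S x - x| ≤ M) := by
    intro σ
    by_cases hσ : 0 < σ
    swap
    · exact ⟨id, fun h => absurd h hσ⟩
    have := isProbabilityMeasure_twoPointGauss ha hb hab w v σ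
    have hF := cdf_twoPointGauss ha hb hab w v hσ
    have : IsProbabilityMeasure ((gaussianReal 0 1).map (fun z => σ * z)) :=
      Measure.isProbabilityMeasure_map (by fun_prop)
    have hG : ∀ y, cdf ((gaussianReal 0 1).map (fun z => σ * z)) y =
        cdf (gaussianReal 0 1) (y / σ) := fun y => by
      have := real_Iic_map_add_mul hσ 0 y
      simp only [zero_add, sub_zero] at this
      rw [cdf_eq_real, this]
    have hΦm := strictMono_cdf_gaussianReal
    have hΦc := continuous_cdf_gaussianReal
    have hmono : ∀ x y : ℝ, x ≤ y →
        cdf (gaussianReal 0 1) (x / σ) ≤ cdf (gaussianReal 0 1) (y / σ) := fun x y hxy =>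
      hΦm.monotone (by gcongr)
    obtain ⟨S, hS, hmap, hcdf, hbd⟩ := exists_rearrangement
      ((gaussianReal 0 1).map (fun z => σ * z)) (twoPointGauss a b w v σ)
      (by rw [funext hG]; fun_prop)
      (fun x y hxy => by rw [hG, hG]; exact hΦm (by gcongr))
      (by rw [funext hF]; fun_prop)
      (strictMono_cdf_twoPointGauss ha hb hab w v hσ)
      hM
      (fun x => by
        rw [hF, hG]
        have h1 := hmono (x - M) (x - w) (by linarith)
        have h2 := hmono (x - M) (x - v) (by linarith)
        linear_combination a * h1 + b * h2 + (-cdf (gaussianReal 0 1) ((x - M) / σ)) * hab)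
      (fun x => by
        rw [hF, hG]
        have h1 := hmono (x - w) (x + M) (by linarith)
        have h2 := hmono (x - v) (x + M) (by linarith)
        linear_combination a * h1 + b * h2 + cdf (gaussianReal 0 1) ((x + M) / σ) * hab)
    refine ⟨S, fun _ => ⟨hS, ?_, fun z => ?_, hbd⟩⟩
    · rw [← hmap, Measure.map_map hS (by fun_prop)]
      rfl
    · rw [hcdf, hG, mul_div_cancel_left₀ _ hσ.ne']
  choose S hS using key
  refine ⟨fun σ z => S σ (σ * z), fun σ hσ => ⟨(hS σ hσ).1.comp (by fun_prop), (hS σ hσ).2.1⟩, ?_⟩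
  have hlim : ∀ z, Tendsto (fun σ => S σ (σ * z) - σ * z) atTop (𝓝 0) := by
    intro z
    rw [Metric.tendsto_nhds]
    intro η hη
    have hinv : Tendsto (fun σ : ℝ => σ⁻¹) atTop (𝓝[>] 0) := tendsto_inv_atTop_nhdsGT_zero
    filter_upwards [hinv.eventually (eventually_lt_mixture hab hmean z hη),
      hinv.eventually (eventually_mixture_lt hab hmean z hη), eventually_gt_atTop 0]
      with σ h1 h2 hσ
    have hmono := strictMono_cdf_twoPointGauss ha hb hab w v hσ
    have e : ∀ t x : ℝ, z + σ⁻¹ * (t - x) = (σ * z + t - x) / σ := fun t x => by field_simp; ring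
    rw [e, e, ← cdf_twoPointGauss ha hb hab w v hσ, ← (hS σ hσ).2.2.1 z, hmono.lt_iff_lt] at h1 h2
    rw [dist_zero_right, Real.norm_eq_abs, abs_lt]
    constructor <;> linarith
  have h0 : (0 : ℝ≥0∞) = ∫⁻ z, 0 ∂(gaussianReal 0 1) := by simp
  rw [h0]
  -- The displacement bound `M` is independent of `σ` and `z`, so a constant dominates.
  refine tendsto_lintegral_filter_of_dominated_convergence (fun _ => ENNReal.ofReal M ^ p)
    ?_ ?_ ?_ ?_
  · filter_upwards [eventually_gt_atTop 0] with σ hσ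
    have := (hS σ hσ).1
    fun_prop
  · filter_upwards [eventually_gt_atTop 0] with σ hσ
    refine Eventually.of_forall fun z => ?_
    gcongr
    rw [Real.enorm_eq_ofReal_abs]
    exact ENNReal.ofReal_le_ofReal ((hS σ hσ).2.2.2 _)
  · simp [ENNReal.rpow_eq_top_iff, hp.not_gt]
  · refine Eventually.of_forall fun z => ?_
    have h1 : Tendsto (fun σ => ‖S σ (σ * z) - σ * z‖ₑ) atTop (𝓝 0) := by
      simpa using (hlim z).enorm
    have h2 := (ENNReal.continuous_rpow_const (y := p)).tendsto 0 |>.comp h1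
    simpa [ENNReal.zero_rpow_of_pos hp, Function.comp_def] using h2

/-! ### Monotonicity and continuity in the noise level -/

lemma Wp_self (hp : 0 < p) (μ : Measure (EuclideanSpace ℝ (Fin d))) : Wp p μ μ = 0 := by
  have h := Wp_map_le hp.le μ (f := id) (g := id) measurable_id measurable_id
  simpa [hp, hp.not_gt] using h

lemma Wp_comm_le (hp : 0 < p) (μ ν : Measure (EuclideanSpace ℝ (Fin d))) :
    Wp p μ ν ≤ Wp p ν μ := by
  refine le_of_forall_gt fun c hc => ?_
  obtain ⟨π, hπ, hlt⟩ := exists_coupling_of_Wp_lt hp hc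
  have h := Wp_map_le hp.le π measurable_snd measurable_fst
  have e1 : π.map Prod.fst = ν := hπ.1
  have e2 : π.map Prod.snd = μ := hπ.2
  rw [e1, e2] at h
  refine h.trans_lt (lt_of_eq_of_lt ?_ hlt)
  simp_rw [enorm_sub_rev (Prod.snd _) (Prod.fst _)]

lemma Wp_dirac_dirac_le (hp : 0 < p) (x y : EuclideanSpace ℝ (Fin d)) :
    Wp p (.dirac x) (.dirac y) ≤ ‖x - y‖ₑ := by
  have h := Wp_map_le hp.le (Measure.dirac x) (f := fun _ => x) (g := fun _ => y)
    measurable_const measurable_const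
  simpa [hp.ne'] using h

lemma smoothWp_le_Wp (hp : 0 < p) (σ : ℝ) (μ ν : Measure (EuclideanSpace ℝ (Fin d)))
    [IsProbabilityMeasure μ] : smoothWp p σ μ ν ≤ Wp p μ ν :=
  Wp_conv_le hp μ ν _

lemma smoothWp_triangle (hp : 1 ≤ p) (σ : ℝ) (μ ν ρ : Measure (EuclideanSpace ℝ (Fin d)))
    [IsProbabilityMeasure μ] [IsProbabilityMeasure ν] :
    smoothWp p σ μ ρ ≤ smoothWp p σ μ ν + smoothWp p σ ν ρ :=
  Wp_triangle hp _ _ _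

lemma smoothWp_zero (μ ν : Measure (EuclideanSpace ℝ (Fin d))) [IsProbabilityMeasure μ]
    [IsProbabilityMeasure ν] : smoothWp p 0 μ ν = Wp p μ ν := by
  rw [smoothWp, gauss_zero, Measure.conv_dirac_zero, Measure.conv_dirac_zero]

lemma smoothWp_antitoneOn (hp : 0 < p) (μ ν : Measure (EuclideanSpace ℝ (Fin d)))
    [IsProbabilityMeasure μ] [IsProbabilityMeasure ν] :
    AntitoneOn (fun σ : ℝ => smoothWp p σ μ ν) (Ici 0) := by
  intro s hs t _ hst
  -- Passing from level `s` to level `t` takes extra noise of variance `t² - s²`.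
  have hsq : 0 ≤ t ^ 2 - s ^ 2 := sub_nonneg.2 (pow_le_pow_left₀ hs hst 2)
  have h : s ^ 2 + √(t ^ 2 - s ^ 2) ^ 2 = t ^ 2 := by rw [Real.sq_sqrt hsq]; ring
  simp only [smoothWp]
  rw [← gauss_conv_gauss s _ t h, ← Measure.conv_assoc, ← Measure.conv_assoc]
  exact Wp_conv_le hp _ _ _

lemma Wp_conv_gauss_le (hp : 0 < p) (μ : Measure (EuclideanSpace ℝ (Fin d)))
    [IsProbabilityMeasure μ] (s t : ℝ) :
    Wp p (μ.conv (gauss d s)) (μ.conv (gauss d t)) ≤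
      (∫⁻ x, ‖x‖ₑ ^ p ∂(gauss d 1)) ^ (1 / p) * edist s t := by
  have key : ∀ r : ℝ, μ.conv (gauss d r) =
      (μ.prod (gauss d 1)).map (fun z => z.1 + r • z.2) := fun r => by
    rw [Measure.conv, gauss_eq_map_smul r, ← Measure.map_id (μ := μ),
      Measure.map_prod_map _ _ measurable_id (by fun_prop),
      Measure.map_map (by fun_prop) (by fun_prop), Measure.map_id]
    rfl
  rw [key s, key t]
  refine (Wp_map_le hp.le _ (by fun_prop) (by fun_prop)).trans_eq ?_
  have h : ∀ z : EuclideanSpace ℝ (Fin d) × EuclideanSpace ℝ (Fin d),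
      ‖z.1 + s • z.2 - (z.1 + t • z.2)‖ₑ ^ p = edist s t ^ p * ‖z.2‖ₑ ^ p := fun z => by
    rw [add_sub_add_left_eq_sub, ← sub_smul, enorm_smul, ENNReal.mul_rpow_of_nonneg _ _ hp.le,
      edist_eq_enorm_sub]
  simp_rw [h]
  rw [lintegral_const_mul _ (by fun_prop), lintegral_prod _ (by fun_prop)]
  simp only [lintegral_const, measure_univ, mul_one]
  rw [ENNReal.mul_rpow_of_nonneg _ _ (by positivity), one_div, ENNReal.rpow_rpow_inv hp.ne',
    mul_comm]

lemma continuous_smoothWp (hp : 1 ≤ p) (μ ν : Measure (EuclideanSpace ℝ (Fin d)))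
    [IsProbabilityMeasure μ] [IsProbabilityMeasure ν] :
    Continuous (fun σ : ℝ => smoothWp p σ μ ν) := by
  have hp0 : 0 < p := by linarith
  set K := (∫⁻ x, ‖x‖ₑ ^ p ∂(gauss d 1)) ^ (1 / p) with hK
  have hKtop : K ≠ ∞ :=
    ENNReal.rpow_ne_top_of_nonneg (by positivity) (lintegral_enorm_rpow_gauss_ne_top hp0 1)
  refine continuous_of_le_add_edist (2 * K) (ENNReal.mul_ne_top (by simp) hKtop) fun s t => ?_
  calc smoothWp p s μ ν
      ≤ Wp p (μ.conv (gauss d s)) (μ.conv (gauss d t)) +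
          (smoothWp p t μ ν + Wp p (ν.conv (gauss d t)) (ν.conv (gauss d s))) :=
        (Wp_triangle hp _ _ _).trans (add_le_add le_rfl (Wp_triangle hp _ _ _))
    _ ≤ K * edist s t + (smoothWp p t μ ν + K * edist s t) := by
        gcongr
        · exact Wp_conv_gauss_le hp0 μ s t
        · rw [edist_comm]
          exact Wp_conv_gauss_le hp0 ν t s
    _ = smoothWp p t μ ν + 2 * K * edist s t := by ring

/-! ### Large noise -/

lemma tendsto_smoothWp_twoPoint (hp : 0 < p) {a b : ℝ} (ha : 0 ≤ a) (hb : 0 ≤ b) (hab : a + b = 1)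
    (x y : EuclideanSpace ℝ (Fin d)) :
    Tendsto (fun σ => smoothWp p σ
      (ENNReal.ofReal a • Measure.dirac x + ENNReal.ofReal b • Measure.dirac y)
      (.dirac (a • x + b • y))) atTop (𝓝 0) := by
  rcases eq_or_ne x y with rfl | hxy
  · rw [← add_smul, ← add_smul, ← ENNReal.ofReal_add ha hb, hab]
    simp [smoothWp, Wp_self hp]
  set L := ‖x - y‖ with hL
  have hL0 : L ≠ 0 := norm_ne_zero_iff.2 (sub_ne_zero.2 hxy)
  set u : EuclideanSpace ℝ (Fin d) := L⁻¹ • (x - y) with hudef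
  have hu : ‖u‖ = 1 := by rw [hudef, norm_smul, norm_inv, hL, norm_norm, inv_mul_cancel₀ hL0]
  set m := a • x + b • y with hm
  have hx : m + (b * L) • u = x := by
    rw [hudef, smul_smul, mul_assoc, mul_inv_cancel₀ hL0, mul_one, hm, smul_sub,
      add_add_sub_cancel, ← add_smul, hab, one_smul]
  have hy : m + (-a * L) • u = y := by
    rw [hudef, smul_smul, mul_assoc, mul_inv_cancel₀ hL0, mul_one, hm, neg_smul, smul_sub,
      neg_sub, add_comm (a • x), add_add_sub_cancel, add_comm, ← add_smul, hab, one_smul]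
  -- `b * L` and `-a * L` are the coordinates of `x` and `y` along `u`, measured from the mean `m`.
  obtain ⟨T, hT, hlim⟩ := exists_transport_twoPointGauss hp ha hb hab
    (w := b * L) (v := -a * L) (by ring)
  have hlim' : Tendsto (fun σ => (∫⁻ z, ‖T σ z - σ * z‖ₑ ^ p ∂(gaussianReal 0 1)) ^ (1 / p)) atTop
      (𝓝 0) := by
    have h2 := (ENNReal.continuous_rpow_const (y := 1 / p)).tendsto 0 |>.comp hlim
    simpa [ENNReal.zero_rpow_of_pos (inv_pos.2 hp), Function.comp_def] using h2
  refine tendsto_of_tendsto_of_tendsto_of_le_of_le' tendsto_const_nhds hlim'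
    (Eventually.of_forall fun _ => zero_le) ?_
  filter_upwards [eventually_gt_atTop 0] with σ hσ
  obtain ⟨hTm, hTmap⟩ := hT σ hσ
  have hprob : IsProbabilityMeasure
      (ENNReal.ofReal a • Measure.dirac x + ENNReal.ofReal b • Measure.dirac y) :=
    ⟨by simp [← ENNReal.ofReal_add ha hb, hab]⟩
  -- The orthogonal noise is common to both laws and is dropped by contraction.
  rw [smoothWp, ← gaussLine_conv_gaussPerp hu σ, ← Measure.conv_assoc, ← Measure.conv_assoc]
  refine (Wp_conv_le hp _ _ _).trans ?_
  have e₁ : (ENNReal.ofReal a • Measure.dirac x + ENNReal.ofReal b • Measure.dirac y).conv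
      (gaussLine u σ) = (gaussianReal 0 1).map (fun z => m + T σ z • u) := by
    have h1 : (gaussianReal 0 1).map (fun z => m + T σ z • u) =
        (twoPointGauss a b (b * L) (-a * L) σ).map (fun s => m + s • u) := by
      rw [← hTmap, Measure.map_map (by fun_prop) hTm]
      rfl
    rw [h1, twoPointGauss, Measure.map_add _ _ (by fun_prop), Measure.map_smul, Measure.map_smul,
      Measure.map_map (by fun_prop) (by fun_prop), Measure.map_map (by fun_prop) (by fun_prop),
      Measure.add_conv, Measure.conv_smul_left, Measure.conv_smul_left, Measure.dirac_conv,
      Measure.dirac_conv, gaussLine, Measure.map_map (by fun_prop) (by fun_prop),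
      Measure.map_map (by fun_prop) (by fun_prop)]
    congr 3 <;> ext1 z
    · change x + (σ * z) • u = m + (b * L + σ * z) • u
      rw [add_smul, ← add_assoc, hx]
    · change y + (σ * z) • u = m + (-a * L + σ * z) • u
      rw [add_smul, ← add_assoc, hy]
  have e₂ : (Measure.dirac m).conv (gaussLine u σ) =
      (gaussianReal 0 1).map (fun z => m + (σ * z) • u) := by
    rw [Measure.dirac_conv, gaussLine, Measure.map_map (by fun_prop) (by fun_prop)]
    rfl
  rw [e₁, e₂]
  refine (Wp_map_le hp.le _ (by fun_prop) (by fun_prop)).trans_eq ?_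
  have hu' : ‖u‖ₑ = 1 := by rw [← ofReal_norm, hu, ENNReal.ofReal_one]
  simp only [add_sub_add_left_eq_sub, ← sub_smul, enorm_smul, hu', mul_one]

/-- Convexity replaces each component by its point mass; the two-point case then merges these two
masses. -/
lemma tendsto_smoothWp_convexComb (hp : 1 ≤ p) {a b : ℝ} (ha : 0 < a) (hb : 0 < b)
    (hab : a + b = 1) {μ₁ μ₂ : Measure (EuclideanSpace ℝ (Fin d))} [IsProbabilityMeasure μ₁]
    [IsProbabilityMeasure μ₂] {m₁ m₂ : EuclideanSpace ℝ (Fin d)}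
    (h₁ : Tendsto (fun σ => smoothWp p σ μ₁ (.dirac m₁)) atTop (𝓝 0))
    (h₂ : Tendsto (fun σ => smoothWp p σ μ₂ (.dirac m₂)) atTop (𝓝 0)) :
    Tendsto (fun σ => smoothWp p σ (ENNReal.ofReal a • μ₁ + ENNReal.ofReal b • μ₂)
      (.dirac (a • m₁ + b • m₂))) atTop (𝓝 0) := by
  have hp0 : 0 < p := by linarith
  have hprob : ∀ ν₁ ν₂ : Measure (EuclideanSpace ℝ (Fin d)), IsProbabilityMeasure ν₁ →
      IsProbabilityMeasure ν₂ →
      IsProbabilityMeasure (ENNReal.ofReal a • ν₁ + ENNReal.ofReal b • ν₂) := fun ν₁ ν₂ _ _ =>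
    ⟨by simp [← ENNReal.ofReal_add ha.le hb.le, hab]⟩
  have := hprob μ₁ μ₂ inferInstance inferInstance
  have := hprob (.dirac m₁) (.dirac m₂) inferInstance inferInstance
  have hpow : Tendsto (fun σ => (ENNReal.ofReal a * smoothWp p σ μ₁ (.dirac m₁) ^ p +
      ENNReal.ofReal b * smoothWp p σ μ₂ (.dirac m₂) ^ p) ^ (1 / p)) atTop (𝓝 0) := by
    have hc : Continuous fun q : ℝ≥0∞ × ℝ≥0∞ =>
        (ENNReal.ofReal a * q.1 ^ p + ENNReal.ofReal b * q.2 ^ p) ^ (1 / p) := by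
      have h (c : ℝ) : Continuous fun q : ℝ≥0∞ => ENNReal.ofReal c * q ^ p :=
        (ENNReal.continuous_const_mul ENNReal.ofReal_ne_top).comp ENNReal.continuous_rpow_const
      exact ENNReal.continuous_rpow_const.comp
        (((h a).comp continuous_fst).add ((h b).comp continuous_snd))
    have := (hc.tendsto (0, 0)).comp (h₁.prodMk_nhds h₂)
    simpa [ENNReal.zero_rpow_of_pos hp0, ENNReal.zero_rpow_of_pos (inv_pos.2 hp0),
      Function.comp_def] using this
  have hsum := hpow.add (tendsto_smoothWp_twoPoint hp0 ha.le hb.le hab m₁ m₂)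
  rw [add_zero] at hsum
  refine tendsto_of_tendsto_of_tendsto_of_le_of_le tendsto_const_nhds hsum (fun _ => zero_le)
    fun σ => ?_
  refine (smoothWp_triangle hp σ _
    (ENNReal.ofReal a • Measure.dirac m₁ + ENNReal.ofReal b • Measure.dirac m₂) _).trans ?_
  gcongr
  rw [one_div, ENNReal.le_rpow_inv_iff hp0]
  simp only [smoothWp, Measure.add_conv, Measure.conv_smul_left]
  exact Wp_rpow_convexComb_le hp0 (by simpa using ha) (by simp) (by simpa using hb) (by simp) _ _ _ _

lemma tendsto_smoothWp_sum_dirac (hp : 1 ≤ p) (s : Finset (EuclideanSpace ℝ (Fin d)))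
    (w : EuclideanSpace ℝ (Fin d) → ℝ) (hw : ∀ x, 0 ≤ w x) (hsum : ∑ x ∈ s, w x = 1) :
    Tendsto (fun σ => smoothWp p σ (∑ x ∈ s, ENNReal.ofReal (w x) • Measure.dirac x)
      (.dirac (∑ x ∈ s, w x • x))) atTop (𝓝 0) := by
  have hp0 : 0 < p := by linarith
  induction s using Finset.induction_on generalizing w with
  | empty => simp at hsum
  | insert y s hy ih =>
    rw [Finset.sum_insert hy] at hsum
    rw [Finset.sum_insert hy, Finset.sum_insert hy]
    -- Zero weights are treated apart: merging needs both weights positive, and the rest is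
    -- renormalised by its mass `c`.
    rcases (hw y).eq_or_lt with h0 | h0
    · rw [← h0]
      simpa using ih w hw (by linarith)
    set c := ∑ x ∈ s, w x with hc
    rcases (Finset.sum_nonneg fun x _ => hw x : 0 ≤ c).eq_or_lt with hc0 | hc0
    · have hz : ∀ x ∈ s, w x = 0 := (Finset.sum_eq_zero_iff_of_nonneg fun x _ => hw x).1 hc0.symm
      have h1 : w y = 1 := by linarith
      rw [Finset.sum_eq_zero (fun x hx => by rw [hz x hx, ENNReal.ofReal_zero, zero_smul]),
        Finset.sum_eq_zero (fun x hx => by rw [hz x hx, zero_smul]), h1]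
      simp [smoothWp, Wp_self hp0]
    · have hs1 : ∑ x ∈ s, w x / c = 1 := by rw [← Finset.sum_div, ← hc, div_self hc0.ne']
      have hprob : IsProbabilityMeasure
          (∑ x ∈ s, ENNReal.ofReal (w x / c) • Measure.dirac x) := ⟨by
        simp only [Measure.coe_finsetSum, Finset.sum_apply, Measure.smul_apply, measure_univ,
          smul_eq_mul, mul_one]
        rw [← ENNReal.ofReal_sum_of_nonneg fun x _ => div_nonneg (hw x) hc0.le, hs1,
          ENNReal.ofReal_one]⟩
      have hdir : Tendsto (fun σ => smoothWp p σ (.dirac y) (.dirac y)) atTop (𝓝 0) := by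
        simp [smoothWp, Wp_self hp0]
      have h := tendsto_smoothWp_convexComb hp h0 hc0 hsum hdir
        (ih (fun x => w x / c) (fun x => div_nonneg (hw x) hc0.le) hs1)
      convert h using 4
      · rw [Finset.smul_sum]
        refine Finset.sum_congr rfl fun x _ => ?_
        rw [smul_smul, ← ENNReal.ofReal_mul hc0.le, mul_div_cancel₀ _ hc0.ne']
      · rw [Finset.smul_sum]
        congr 1
        refine Finset.sum_congr rfl fun x _ => ?_
        rw [smul_smul, mul_div_cancel₀ _ hc0.ne']

lemma map_simpleFunc_eq_sum_dirac {Ω : Type*} [MeasurableSpace Ω] (μ : Measure Ω)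
    [IsFiniteMeasure μ] (g : SimpleFunc Ω (EuclideanSpace ℝ (Fin d))) :
    μ.map g = ∑ x ∈ g.range, ENNReal.ofReal (μ.real (g ⁻¹' {x})) • Measure.dirac x := by
  refine Measure.ext_of_lintegral _ fun f hf => ?_
  rw [lintegral_map hf g.measurable, lintegral_finsetSum_measure]
  have h := SimpleFunc.map_lintegral (μ := μ) f g
  rw [← SimpleFunc.lintegral_eq_lintegral] at h
  refine h.trans (Finset.sum_congr rfl fun x _ => ?_)
  rw [lintegral_smul_measure, lintegral_dirac, ofReal_measureReal, smul_eq_mul, mul_comm]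

lemma memLp_id_of_integrable (hp : 0 < p) {μ : Measure (EuclideanSpace ℝ (Fin d))}
    (hμ : Integrable (fun x => ‖x‖ ^ p) μ) : MemLp id (ENNReal.ofReal p) μ := by
  refine ⟨by fun_prop, ?_⟩
  rw [eLpNorm_lt_top_iff_lintegral_rpow_enorm_lt_top (by simpa using hp) (by simp),
    ENNReal.toReal_ofReal hp.le]
  exact (lintegral_enorm_rpow_ne_top hp.le hμ).lt_top

lemma integrable_id_of_integrable (hp : 1 ≤ p) {μ : Measure (EuclideanSpace ℝ (Fin d))}
    [IsProbabilityMeasure μ] (hμ : Integrable (fun x => ‖x‖ ^ p) μ) :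
    Integrable (fun x => x) μ :=
  (memLp_id_of_integrable (by linarith) hμ).integrable (by simpa using hp)

/-- Under large Gaussian noise, a law becomes indistinguishable from the point mass at its mean. -/
theorem tendsto_smoothWp_dirac_mean (hp : 1 ≤ p) {μ : Measure (EuclideanSpace ℝ (Fin d))}
    [IsProbabilityMeasure μ] (hμ : Integrable (fun x => ‖x‖ ^ p) μ) :
    Tendsto (fun σ => smoothWp p σ μ (.dirac (∫ x, x ∂μ))) atTop (𝓝 0) := by
  have hp0 : 0 < p := by linarith
  have hi := integrable_id_of_integrable hp hμ
  rw [ENNReal.tendsto_nhds_zero]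
  intro ε hε
  have hε3 : ε / 3 ≠ 0 := ENNReal.div_ne_zero.2 ⟨hε.ne', by simp⟩
  obtain ⟨g, hg, hgLp⟩ := (memLp_id_of_integrable hp0 hμ).exists_simpleFunc_eLpNorm_sub_lt
    (by simp) hε3
  rw [eLpNorm_eq_lintegral_rpow_enorm_toReal (by simpa using hp0) (by simp),
    ENNReal.toReal_ofReal hp0.le] at hg
  have hgi : Integrable g μ := hgLp.integrable (by simpa using hp)
  have hprob : IsProbabilityMeasure (μ.map g) :=
    Measure.isProbabilityMeasure_map g.measurable.aemeasurable
  have hWg : Wp p μ (μ.map g) ≤ ε / 3 := by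
    have h := Wp_map_le hp0.le μ measurable_id g.measurable
    rw [Measure.map_id] at h
    exact h.trans hg.le
  have hmean : ∫ x, x ∂(μ.map g) = ∑ x ∈ g.range, μ.real (g ⁻¹' {x}) • x := by
    rw [integral_map g.measurable.aemeasurable (by fun_prop), SimpleFunc.integral_eq_sum _ hgi]
  have hgi' : Integrable (fun x => x) (μ.map g) :=
    (integrable_map_measure (by fun_prop) g.measurable.aemeasurable).2 hgi
  have hsum := tendsto_smoothWp_sum_dirac hp g.range (fun x => μ.real (g ⁻¹' {x}))
    (fun _ => measureReal_nonneg) (by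
      simp only [measureReal_def]
      rw [← ENNReal.toReal_sum fun _ _ => measure_ne_top _ _,
        g.sum_range_measure_preimage_singleton, measure_univ, ENNReal.toReal_one])
  rw [← map_simpleFunc_eq_sum_dirac, ← hmean] at hsum
  filter_upwards [ENNReal.tendsto_nhds_zero.1 hsum _ (pos_iff_ne_zero.2 hε3)] with σ hσ
  calc smoothWp p σ μ (.dirac (∫ x, x ∂μ))
      ≤ smoothWp p σ μ (μ.map g) + (smoothWp p σ (μ.map g) (.dirac (∫ x, x ∂(μ.map g))) +
          smoothWp p σ (.dirac (∫ x, x ∂(μ.map g))) (.dirac (∫ x, x ∂μ))) :=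
        (smoothWp_triangle hp σ _ _ _).trans
          (add_le_add le_rfl (smoothWp_triangle hp σ _ _ _))
    _ ≤ ε / 3 + (ε / 3 + ε / 3) := by
        gcongr
        · exact (smoothWp_le_Wp hp0 σ _ _).trans hWg
        -- The error in the mean is itself bounded by the distance between `μ` and its
        -- approximation.
        · refine (smoothWp_le_Wp hp0 σ _ _).trans ((Wp_dirac_dirac_le hp0 _ _).trans ?_)
          rw [enorm_sub_rev, ← ofReal_norm]
          exact (enorm_integral_sub_le_Wp hp μ _ hi hgi').trans hWg
    _ = ε := by rw [← add_assoc, ENNReal.add_thirds]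

/-! ### Preservation of means and the limit at infinity -/

lemma integrable_id_conv_gauss {μ : Measure (EuclideanSpace ℝ (Fin d))} [IsProbabilityMeasure μ]
    (hμ : Integrable (fun x => x) μ) (σ : ℝ) :
    Integrable (fun x => x) (μ.conv (gauss d σ)) := by
  have hG : IsGaussian (gauss d σ) := by unfold gauss; infer_instance
  rw [Measure.conv, integrable_map_measure (by fun_prop) (by fun_prop)]
  exact (hμ.comp_fst _).add (IsGaussian.integrable_id.comp_snd μ)

lemma integral_id_conv_gauss {μ : Measure (EuclideanSpace ℝ (Fin d))} [IsProbabilityMeasure μ]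
    (hμ : Integrable (fun x => x) μ) (σ : ℝ) :
    ∫ x, x ∂(μ.conv (gauss d σ)) = ∫ x, x ∂μ := by
  have hG : IsGaussian (gauss d σ) := by unfold gauss; infer_instance
  have h0 : ∫ x, x ∂(gauss d σ) = 0 := by unfold gauss; simp
  have hGi : Integrable (fun x => x) (gauss d σ) := IsGaussian.integrable_id
  rw [integral_conv (integrable_id_conv_gauss hμ σ)]
  simp_rw [integral_add (integrable_const _) hGi, h0]
  simp

/-- The upper bound passes through the point masses at the two means, which noise cannot move
further apart. -/
theorem tendsto_smoothWp_atTop (hp : 1 ≤ p) {μ ν : Measure (EuclideanSpace ℝ (Fin d))}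
    [IsProbabilityMeasure μ] [IsProbabilityMeasure ν]
    (hμ : Integrable (fun x => ‖x‖ ^ p) μ) (hν : Integrable (fun x => ‖x‖ ^ p) ν) :
    Tendsto (fun σ : ℝ => smoothWp p σ μ ν) atTop
      (𝓝 (ENNReal.ofReal ‖(∫ x, x ∂μ) - ∫ y, y ∂ν‖)) := by
  have hp0 : 0 < p := by linarith
  have hiμ := integrable_id_of_integrable hp hμ
  have hiν := integrable_id_of_integrable hp hν
  have hup : Tendsto (fun σ => smoothWp p σ μ (.dirac (∫ x, x ∂μ)) +
      (ENNReal.ofReal ‖(∫ x, x ∂μ) - ∫ y, y ∂ν‖ + smoothWp p σ ν (.dirac (∫ x, x ∂ν)))) atTop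
      (𝓝 (ENNReal.ofReal ‖(∫ x, x ∂μ) - ∫ y, y ∂ν‖)) := by
    simpa using (tendsto_smoothWp_dirac_mean hp hμ).add
      ((tendsto_const_nhds (x := ENNReal.ofReal ‖(∫ x, x ∂μ) - ∫ y, y ∂ν‖)).add
        (tendsto_smoothWp_dirac_mean hp hν))
  refine tendsto_of_tendsto_of_tendsto_of_le_of_le tendsto_const_nhds hup (fun σ => ?_) fun σ => ?_
  · have h := enorm_integral_sub_le_Wp hp _ _ (integrable_id_conv_gauss hiμ σ)
      (integrable_id_conv_gauss hiν σ)
    rwa [integral_id_conv_gauss hiμ, integral_id_conv_gauss hiν] at h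
  · refine (smoothWp_triangle hp σ μ (.dirac (∫ x, x ∂μ)) ν).trans (add_le_add le_rfl ?_)
    refine (smoothWp_triangle hp σ _ (.dirac (∫ x, x ∂ν)) ν).trans (add_le_add ?_ ?_)
    · rw [ofReal_norm]
      exact (smoothWp_le_Wp hp0 σ _ _).trans (Wp_dirac_dirac_le hp0 _ _)
    · exact Wp_comm_le hp0 _ _

end SmoothWasserstein

theorem corollary1 (d : ℕ) (p : ℝ) (hp : 1 ≤ p)
    (μ ν : Measure (EuclideanSpace ℝ (Fin d)))
    [IsProbabilityMeasure μ] [IsProbabilityMeasure ν]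
    (hμ : Integrable (fun x => ‖x‖ ^ p) μ) (hν : Integrable (fun x => ‖x‖ ^ p) ν) :
    (∀ σ : ℝ, 0 ≤ σ → SmoothWasserstein.smoothWp p σ μ ν ≠ ∞) ∧
    (ContinuousOn (fun σ : ℝ => SmoothWasserstein.smoothWp p σ μ ν) (Set.Ici 0) ∧
      AntitoneOn (fun σ : ℝ => SmoothWasserstein.smoothWp p σ μ ν) (Set.Ici 0)) ∧
    Tendsto (fun σ : ℝ => SmoothWasserstein.smoothWp p σ μ ν) (𝓝[>] 0)
      (𝓝 (SmoothWasserstein.Wp p μ ν)) ∧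
    ((∃ β : ℝ, SmoothWasserstein.IsSubGaussian β μ) →
      (∃ β : ℝ, SmoothWasserstein.IsSubGaussian β ν) →
      Tendsto (fun σ : ℝ => SmoothWasserstein.smoothWp p σ μ ν) atTop
        (𝓝 (ENNReal.ofReal ‖(∫ x, x ∂μ) - ∫ y, y ∂ν‖))) := by
  have hp0 : 0 < p := by linarith
  have hc := SmoothWasserstein.continuous_smoothWp hp μ ν
  refine ⟨fun σ _ => ne_top_of_le_ne_top (SmoothWasserstein.Wp_ne_top hp hμ hν)
    (SmoothWasserstein.smoothWp_le_Wp hp0 σ μ ν),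
    ⟨hc.continuousOn, SmoothWasserstein.smoothWp_antitoneOn hp0 μ ν⟩, ?_,
    fun _ _ => SmoothWasserstein.tendsto_smoothWp_atTop hp hμ hν⟩
  rw [← SmoothWasserstein.smoothWp_zero]
  exact (hc.tendsto 0).mono_left nhdsWithin_le_nhds
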